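/- Let $F$ be a field of characteristic zero. A left Leibniz algebra over $F$ is an $F$-vector space $L$ with a bilinear product satisfying $x(yz)=(xy)z+y(xz)$ for all $x,y,z\in L$. Its Leibniz kernel is $\mathrm{Leib}(L)=\langle x^2\mid x\in L\rangle_F$. An ideal $I$ (a subspace with $LI\subseteq I$ and $IL\subseteq I$) is solvable if $I^{(r)}=0$ for some $r\ge 0$, where $I^{(0)}=I$ and $I^{(n+1)}$ is the linear span of the products of two elements of $I^{(n)}$. The algebra $L$ is semisimple if $\mathrm{Leib}(L)$ contains every solvable ideal of $L$. An $L$-bimodule is an $F$-vector space $M$ with bilinear left and right actions of $L$ such that, for all $x,y\in L$ and $m\in M$, $$(xy)\cdot m=x\cdot(y\cdot m)-y\cdot(x\cdot m),\quad (x\cdot m)\cdot y=x\cdot(m\cdot y)-m\cdot(xy),\quad (m\cdot x)\cdot y=m\cdot(xy)-x\cdot(m\cdot y).$$ It is symmetric if $m\cdot x=-x\cdot m$ for all $x\in L$, $m\in M$, and anti-symmetric if $m\cdot x=0$ for all $x\in L$, $m\in M$. The Leibniz cohomology is $HL^n(L,M)=\ker d^n/\operatorname{im} d^{n-1}$ (with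 $d^{-1}=0$), where $d^n:\mathrm{Hom}_F(L^{\otimes n},M)\to\mathrm{Hom}_F(L^{\otimes (n+1)},M)$ is given by $$(d^nf)(x_1\otimes\cdots\otimes x_{n+1})=\sum_{i=1}^n(-1)^{i+1}x_i\cdot f(x_1\otimes\cdots\otimes\hat x_i\otimes\cdots\otimes x_{n+1})+(-1)^{n+1}f(x_1\otimes\cdots\otimes x_n)\cdot x_{n+1}$$ $$+\sum_{1\le i<j\le n+1}(-1)^if(x_1\otimes\cdots\otimes\hat x_i\otimes\cdots\otimes x_ix_j\otimes\cdots\otimes x_{n+1}),$$ with $x_ix_j$ in the place of $x_j$. Theorem. Let $L$ be a finite-dimensional semisimple left Leibniz algebra over $F$. Then $HL^1(L,M)=0$ for every finite-dimensional symmetric $L$-bimodule $M$. This fails for anti-symmetric bimodules: if moreover $L\neq 0$, then $HL^1(L,L_a)\neq 0$, where $L_a$ is the anti-symmetric $L$-bimodule with underlying space $L$, left action given by left multiplication, and zero right action. In particular, over every field $F$ of characteristic zero there are a finite-dimensional semisimple left Leibniz algebra $L$ and a finite-dimensional anti-symmetric $L$-bimodule $M$ with $HL^1(L,M)\neq 0$.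 -/

import Mathlib

universe u v w

/-- A (not necessarily associative) algebra is a *left Leibniz algebra* if every left
multiplication operator is a derivation. The algebra structure itself (a vector space over `F`
with a bilinear product) is expressed by the Mathlib classes `NonUnitalNonAssocRing L`,
`Module F L`, `IsScalarTower F L L`, `SMulCommClass F L L`. -/
class IsLeftLeibniz (L : Type v) [NonUnitalNonAssocRing L] : Prop where
  leibniz : ∀ x y z : L, x * (y * z) = (x * y) * z + y * (x * z)

namespace LeftLeibniz

section Ideals

variable (F : Type u) (L : Type v) [Field F] [NonUnitalNonAssocRing L] [Module F L]

/-- The Leibniz kernel: the linear span of all squares. -/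
def leibnizKernel : Submodule F L :=
  Submodule.span F {a : L | ∃ x : L, a = x * x}

variable {F L}

/-- A subspace which is a left and right ideal. -/
def IsIdeal (I : Submodule F L) : Prop :=
  ∀ a ∈ I, ∀ x : L, x * a ∈ I ∧ a * x ∈ I

/-- The derived series of (a subalgebra with underlying space) `S`:
`S⁽⁰⁾ = S`, and `S⁽ⁿ⁺¹⁾` is the span of all products of two elements of `S⁽ⁿ⁾`. -/
def derivedSeries (S : Submodule F L) : ℕ → Submodule F L
  | 0 => S
  | n + 1 => Submodule.span F
      {a : L | ∃ x ∈ derivedSeries S n, ∃ y ∈ derivedSeries S n, a = x * y}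

/-- `S⁽ʳ⁾ = 0` for some `r`. -/
def IsSolvable (S : Submodule F L) : Prop :=
  ∃ r : ℕ, derivedSeries S r = ⊥

variable (F L)

/-- Semisimplicity: the Leibniz kernel contains every solvable ideal. -/
def IsSemisimple : Prop :=
  ∀ I : Submodule F L, IsIdeal I → IsSolvable I → I ≤ leibnizKernel F L

end Ideals

/-- The structure of a bimodule over the left Leibniz algebra `L` on the vector space `M`:
`left x m` is `x · m` and `right m x` is `m · x`. -/
structure Bimodule (F : Type u) (L : Type v) (M : Type w) [Field F] [NonUnitalNonAssocRing L]
    [Module F L] [AddCommGroup M] [Module F M] where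
  left : L →ₗ[F] M →ₗ[F] M
  right : M →ₗ[F] L →ₗ[F] M
  llm : ∀ (x y : L) (m : M), left (x * y) m = left x (left y m) - left y (left x m)
  lml : ∀ (x y : L) (m : M), right (left x m) y = left x (right m y) - right m (x * y)
  mll : ∀ (x y : L) (m : M), right (right m x) y = right m (x * y) - left x (right m y)

namespace Bimodule

variable {F : Type u} {L : Type v} {M : Type w} [Field F] [NonUnitalNonAssocRing L]
  [Module F L] [AddCommGroup M] [Module F M]

/-- `m · x = - x · m`. -/
def IsSymmetric (B : Bimodule F L M) : Prop :=
  ∀ (x : L) (m : M), B.right m x = - B.left x m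

/-- `m · x = 0`. -/
def IsAntisymmetric (B : Bimodule F L M) : Prop :=
  ∀ (x : L) (m : M), B.right m x = 0

end Bimodule

/-- The anti-symmetric adjoint bimodule of `L`: the space `L` on which `L` acts from the left by
left multiplication and from the right by zero. -/
def antisymmetricAdjoint (F : Type u) (L : Type v) [Field F] [NonUnitalNonAssocRing L]
    [Module F L] [IsScalarTower F L L] [SMulCommClass F L L] [IsLeftLeibniz L] :
    Bimodule F L L where
  left := LinearMap.mul F L
  right := 0
  llm x y m := by
    simp only [LinearMap.mul_apply']
    rw [IsLeftLeibniz.leibniz x y m]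
    abel
  lml x y m := by simp
  mll x y m := by simp

theorem removeNth_update_ne {L : Type v} {n : ℕ} (i k : Fin (n + 1)) (h : k ≠ i) :
    ∃ k' : Fin n, i.succAbove k' = k ∧ ∀ (x : Fin (n + 1) → L) (a : L),
      i.removeNth (Function.update x k a) = Function.update (i.removeNth x) k' a := by
  obtain ⟨k', rfl⟩ := Fin.exists_succAbove_eq h
  exact ⟨k', rfl, fun x a => Fin.removeNth_update_succAbove i k' a x⟩

theorem removeNth_update_self {L : Type v} {n : ℕ} (i : Fin (n + 1)) (x : Fin (n + 1) → L) (a : L) :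
    i.removeNth (Function.update x i a) = i.removeNth x :=
  Fin.removeNth_update i a x

section Cohomology

variable {F : Type u} {L : Type v} {M : Type w} [Field F] [NonUnitalNonAssocRing L]
  [Module F L] [AddCommGroup M] [Module F M]

variable (F L M) in
/-- The space of `n`-cochains: linear maps from the `n`-th tensor power of `L` to `M`, written as
`n`-linear maps. -/
abbrev Cochain (n : ℕ) : Type (max v w) :=
  MultilinearMap F (fun _ : Fin n => L) M

/-- The value of the coboundary of `f` at `(x₀, …, xₙ)`. The entries are numbered from `0`
here, so the summand with `xᵢ` acting from the left has the sign `(-1)^i`, and the summand in which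
`xᵢ` is deleted and `xⱼ` is replaced by `xᵢ xⱼ` has the sign `(-1)^(i+1)`. -/
def coboundaryFun (B : Bimodule F L M) {n : ℕ} (f : Cochain F L M n) (x : Fin (n + 1) → L) : M :=
  (∑ i : Fin n, (-1 : F) ^ (i : ℕ) •
      B.left (x i.castSucc) (f (i.castSucc.removeNth x)))
    + (-1 : F) ^ (n + 1) • B.right (f ((Fin.last n).removeNth x)) (x (Fin.last n))
    + ∑ i : Fin (n + 1), ∑ j ∈ Finset.Ioi i, (-1 : F) ^ ((i : ℕ) + 1) •
      f (i.removeNth (Function.update x j (x i * x j)))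

/-- `(x₀, …, xₙ) ↦ f (…, x̂ᵢ, …, xᵢ xⱼ, …)` is additive and homogeneous in each entry. -/
theorem mulTerm_update [IsScalarTower F L L] [SMulCommClass F L L] {n : ℕ} (f : Cochain F L M n)
    (i j : Fin (n + 1)) (hij : j ≠ i) (x : Fin (n + 1) → L) (k : Fin (n + 1)) :
    ∃ g : L →ₗ[F] M, ∀ a : L,
      f (i.removeNth (Function.update (Function.update x k a) j
        (Function.update x k a i * Function.update x k a j))) = g a := by
  obtain ⟨j', -, hj⟩ := removeNth_update_ne (L := L) i j hij
  by_cases hki : k = i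
  · subst hki
    refine ⟨(f.toLinearMap (k.removeNth x) j') ∘ₗ (LinearMap.mulRight F (x j)), fun a => ?_⟩
    simp [hj, Function.update_of_ne hij]
  · obtain ⟨k', -, hk⟩ := removeNth_update_ne (L := L) i k hki
    by_cases hkj : k = j
    · subst hkj
      refine ⟨(f.toLinearMap (i.removeNth x) j') ∘ₗ (LinearMap.mulLeft F (x i)), fun a => ?_⟩
      simp [hj, Function.update_of_ne (Ne.symm hki)]
    · refine ⟨f.toLinearMap (i.removeNth (Function.update x j (x i * x j))) k', fun a => ?_⟩
      rw [Function.update_of_ne (Ne.symm hki), Function.update_of_ne (Ne.symm hkj),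
        Function.update_comm hkj, hk, MultilinearMap.toLinearMap_apply]

/-- `(x₀, …, xₙ) ↦ b (xᵢ, f (…, x̂ᵢ, …))` is additive and homogeneous in each entry. -/
theorem actTerm_update {n : ℕ} (b : L →ₗ[F] M →ₗ[F] M) (f : Cochain F L M n)
    (i : Fin (n + 1)) (x : Fin (n + 1) → L) (k : Fin (n + 1)) :
    ∃ g : L →ₗ[F] M, ∀ a : L,
      b (Function.update x k a i) (f (i.removeNth (Function.update x k a))) = g a := by
  by_cases hki : k = i
  · subst hki
    refine ⟨b.flip (f (k.removeNth x)), fun a => ?_⟩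
    simp
  · obtain ⟨k', -, hk⟩ := removeNth_update_ne (L := L) i k hki
    refine ⟨(b (x i)) ∘ₗ (f.toLinearMap (i.removeNth x) k'), fun a => ?_⟩
    simp [hk, Function.update_of_ne (Ne.symm hki)]

theorem coboundaryFun_update [IsScalarTower F L L] [SMulCommClass F L L] (B : Bimodule F L M)
    {n : ℕ} (f : Cochain F L M n) (x : Fin (n + 1) → L) (k : Fin (n + 1)) :
    ∃ g : L →ₗ[F] M, ∀ a : L, coboundaryFun B f (Function.update x k a) = g a := by
  choose g₁ hg₁ using fun i : Fin n => actTerm_update B.left f i.castSucc x k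
  obtain ⟨g₂, hg₂⟩ := actTerm_update B.right.flip f (Fin.last n) x k
  have h₃ : ∀ i j : Fin (n + 1), ∃ g : L →ₗ[F] M, j ∈ Finset.Ioi i → ∀ a : L,
      f (i.removeNth (Function.update (Function.update x k a) j
        (Function.update x k a i * Function.update x k a j))) = g a := by
    intro i j
    by_cases hij : j ∈ Finset.Ioi i
    · obtain ⟨g, hg⟩ := mulTerm_update f i j (ne_of_gt (Finset.mem_Ioi.1 hij)) x k
      exact ⟨g, fun _ => hg⟩
    · exact ⟨0, fun h => absurd h hij⟩
  choose g₃ hg₃ using h₃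
  refine ⟨(∑ i : Fin n, (-1 : F) ^ (i : ℕ) • g₁ i) + (-1 : F) ^ (n + 1) • g₂
    + ∑ i : Fin (n + 1), ∑ j ∈ Finset.Ioi i, (-1 : F) ^ ((i : ℕ) + 1) • g₃ i j, fun a => ?_⟩
  simp only [LinearMap.add_apply, LinearMap.sum_apply, LinearMap.smul_apply, coboundaryFun]
  congr 1
  · congr 1
    · exact Finset.sum_congr rfl fun i _ => by rw [hg₁]
    · rw [← hg₂, LinearMap.flip_apply]
  · exact Finset.sum_congr rfl fun i _ => Finset.sum_congr rfl fun j hj => by rw [hg₃ i j hj]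

/-- The coboundary map `dⁿ` from `n`-cochains to `(n+1)`-cochains. -/
def coboundary [IsScalarTower F L L] [SMulCommClass F L L] (B : Bimodule F L M) (n : ℕ) :
    Cochain F L M n →ₗ[F] Cochain F L M (n + 1) where
  toFun f := MultilinearMap.mk' (coboundaryFun B f)
    (fun x k a b => by
      obtain ⟨g, hg⟩ := coboundaryFun_update B f x k
      rw [hg, hg, hg, map_add])
    (fun x k c a => by
      obtain ⟨g, hg⟩ := coboundaryFun_update B f x k
      rw [hg, hg, map_smul])
  map_add' f g := by
    ext x
    simp only [MultilinearMap.mk'_apply, add_apply, coboundaryFun, map_add,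
      LinearMap.add_apply, smul_add, Finset.sum_add_distrib]
    abel
  map_smul' c f := by
    ext x
    simp only [MultilinearMap.mk'_apply, smul_apply, coboundaryFun, map_smul,
      LinearMap.smul_apply, smul_add, Finset.smul_sum, RingHom.id_apply]
    simp only [smul_comm c]

variable [IsScalarTower F L L] [SMulCommClass F L L]

/-- The kernel of `dⁿ`. -/
def cocycles (B : Bimodule F L M) (n : ℕ) : Submodule F (Cochain F L M n) :=
  LinearMap.ker (coboundary B n)

/-- The image of `dⁿ⁻¹`, where `d⁻¹ = 0`. -/
def coboundaries (B : Bimodule F L M) : (n : ℕ) → Submodule F (Cochain F L M n)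
  | 0 => ⊥
  | n + 1 => LinearMap.range (coboundary B n)

/-- The Leibniz cohomology space `HLⁿ(L, M) = ker dⁿ / im dⁿ⁻¹`. -/
abbrev HL (B : Bimodule F L M) (n : ℕ) : Type (max v w) :=
  cocycles B n ⧸ (coboundaries B n).submoduleOf (cocycles B n)

end Cohomology

end LeftLeibniz

/-! For symmetric `M` the cocycle condition is c(xy) = x·c(y) − y·c(x). Hence c kills squares and
descends to the Lie algebra Q = L/Leib(L). Leib(L) also acts by zero from the left, so `M` is a
Q-module and c a derivation Q → M. The radical of Q is trivial (`IsSemisimple.hasTrivialRadical`),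
so Whitehead's first lemma (`exists_eq_lie_of_isKilling`) gives m with c(x) = x·m = −m·x, which is a
coboundary.

Whitehead's lemma reduces to irreducible modules by induction on dimension. There a Casimir operator
C is invertible and satisfies C(f x) = x·u with u = ∑ eᵢ·f(dᵢ), so m = C⁻¹u.

For a zero right action every 1-coboundary vanishes, while the identity of L is a 1-cocycle into
L_a. The cross product on F³ supplies a nonzero semisimple L over every F. -/

section

/-! ### Invariance of dual bases; perfectness of Killing Lie algebras. -/

open Module

/-- The tensor ∑ eᵢ ⊗ dᵢ represents the form, so every operator skew for the form annihilates it. In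
coordinates, the coefficients of T eᵢ along e and of T dⱼ along d are negatives of each other, and
the double sums cancel after exchanging indices. -/
theorem LinearMap.BilinForm.sum_dualBasis_skew {K V W ι : Type*} [Field K] [AddCommGroup V]
    [Module K V] [AddCommGroup W] [Module K W] [Fintype ι] [DecidableEq ι]
    (B : LinearMap.BilinForm K V) (hB : B.Nondegenerate) (hs : B.IsSymm) (e : Basis ι K V)
    (T : V →ₗ[K] V) (hT : ∀ v w, B (T v) w = - B v (T w)) (β : V →ₗ[K] V →ₗ[K] W) :
    ∑ i, (β (T (e i)) (B.dualBasis hB e i) + β (e i) (T (B.dualBasis hB e i))) = 0 := by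
  set d := B.dualBasis hB e with hd
  have h₁ (v : V) : v = ∑ j, B v (d j) • e j := by
    conv_lhs => rw [← e.sum_repr v]
    refine Finset.sum_congr rfl fun j _ => ?_
    have := B.dualBasis_repr_apply hB d v j
    rw [hd, B.dualBasis_dualBasis hB hs e] at this
    rw [this]
  have h₂ (v : V) : v = ∑ j, B v (e j) • d j := by
    conv_lhs => rw [← d.sum_repr v]
    exact Finset.sum_congr rfl fun j _ => by rw [hd, B.dualBasis_repr_apply hB e]
  have h₃ (i : ι) : β (T (e i)) (d i) = ∑ j, B (T (e i)) (d j) • β (e j) (d i) := by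
    conv_lhs => rw [h₁ (T (e i))]
    simp
  have h₄ (i : ι) : β (e i) (T (d i)) = ∑ j, B (T (d i)) (e j) • β (e i) (d j) := by
    conv_lhs => rw [h₂ (T (d i))]
    simp
  simp only [h₃, h₄, Finset.sum_add_distrib]
  rw [Finset.sum_comm (f := fun i j => B (T (d i)) (e j) • β (e i) (d j)),
    ← Finset.sum_add_distrib]
  refine Finset.sum_eq_zero fun i _ => ?_
  rw [← Finset.sum_add_distrib]
  refine Finset.sum_eq_zero fun j _ => ?_
  rw [hT (d j), hs.eq, neg_smul]
  exact add_neg_cancel _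

namespace LieAlgebra

variable {F Q : Type*} [Field F] [LieRing Q] [LieAlgebra F Q] [FiniteDimensional F Q]

/-- If x is Killing-orthogonal to [Q,Q], then κ([x,y],z) = κ(x,[y,z]) = 0 for all z, so x is
central. The complement of [Q,Q] is therefore an abelian ideal, hence zero. -/
theorem IsKilling.lie_top_top [IsKilling F Q] : ⁅(⊤ : LieIdeal F Q), (⊤ : LieIdeal F Q)⁆ = ⊤ := by
  set D : LieIdeal F Q := ⁅(⊤ : LieIdeal F Q), (⊤ : LieIdeal F Q)⁆ with hD
  have hc := LieIdeal.isCompl_killingCompl D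
  suffices LieIdeal.killingCompl F Q D = ⊥ by
    rw [this] at hc
    simpa using hc.sup_eq_top
  have h (x y : Q) (hx : x ∈ LieIdeal.killingCompl F Q D) : ⁅x, y⁆ = 0 := by
    refine (IsKilling.killingForm_nondegenerate F Q).1 _ fun z => ?_
    rw [killingForm, LieModule.traceForm_apply_lie_apply, LieModule.traceForm_comm]
    exact (LieIdeal.mem_killingCompl F Q D).1 hx _
      (LieSubmodule.lie_mem_lie (LieSubmodule.mem_top _) (LieSubmodule.mem_top _))
  have : IsLieAbelian (LieIdeal.killingCompl F Q D) :=
    ⟨fun x y => Subtype.ext (h x y x.2)⟩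
  exact IsKilling.ideal_eq_bot_of_isLieAbelian _

theorem IsKilling.eq_zero_of_forall_lie [IsKilling F Q] {M : Type*} [AddCommGroup M] [Module F M]
    (f : Q →ₗ[F] M) (hf : ∀ x y : Q, f ⁅x, y⁆ = 0) : f = 0 := by
  rw [← LinearMap.ker_eq_top, eq_top_iff, ← LieSubmodule.top_toSubmodule (R := F) (L := Q),
    ← IsKilling.lie_top_top, LieSubmodule.lieIdeal_oper_eq_linear_span, Submodule.span_le]
  rintro _ ⟨x, y, rfl⟩
  exact hf x y

end LieAlgebra

/-! ### Casimir operators and Whitehead's first lemma. -/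

namespace LieModule

open LieAlgebra

variable {F Q M : Type*} [Field F] [LieRing Q] [LieAlgebra F Q]
  [AddCommGroup M] [Module F M] [LieRingModule Q M] [LieModule F Q M]

variable (F Q M) in
/-- The action of a Lie algebra on a module, as a bilinear map. -/
def lieAction : Q →ₗ[F] M →ₗ[F] M :=
  LinearMap.mk₂ F (fun x m => ⁅x, m⁆) add_lie smul_lie lie_add fun c x m => lie_smul c x m

@[simp]
theorem lieAction_apply (x : Q) (m : M) : lieAction F Q M x m = ⁅x, m⁆ := rfl

variable (F Q M) in
/-- The kernel of the trace form of a Lie module. -/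
noncomputable def traceFormKer : LieIdeal F Q where
  __ := LinearMap.ker (traceForm F Q M)
  lie_mem {x m} hm := by
    have hm : traceForm F Q M m = 0 := hm
    show traceForm F Q M ⁅x, m⁆ = 0
    ext y
    rw [traceForm_apply_lie_apply', hm]
    simp

theorem mem_traceFormKer {x : Q} : x ∈ traceFormKer F Q M ↔ traceForm F Q M x = 0 := Iff.rfl

variable [FiniteDimensional F Q]

/-- Dual bases, with respect to the trace form of `M`, of the Killing complement of its kernel. -/
theorem exists_casimir [IsKilling F Q] :
    ∃ (n : ℕ) (e d : Fin n → Q),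
      (n = 0 → traceForm F Q M = 0) ∧
      (∀ i, traceForm F Q M (e i) (d i) = 1) ∧
      ∀ (x : Q) (β : Q →ₗ[F] Q →ₗ[F] M), ∑ i, (β ⁅x, e i⁆ (d i) + β (e i) ⁅x, d i⁆) = 0 := by
  set K := traceFormKer F Q M
  set J := LieIdeal.killingCompl F Q K
  have hc : IsCompl K J := LieIdeal.isCompl_killingCompl K
  let B : LinearMap.BilinForm F J := (traceForm F Q M).restrict J.toSubmodule
  have hsymm : B.IsSymm := ⟨fun x y => traceForm_comm F Q M x y⟩
  have hB : B.Nondegenerate := by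
    refine (LinearMap.BilinForm.IsSymm.isRefl hsymm).nondegenerate_iff_separatingLeft.2 ?_
    intro x hx
    -- An element of J orthogonal to J is also orthogonal to K, the kernel of the form, hence to K +
    -- J = Q.
    have hxK : (x : Q) ∈ K := by
      rw [mem_traceFormKer]
      ext z
      obtain ⟨k, hk, j, hj, rfl⟩ := (LieSubmodule.mem_sup K J z).1
        (hc.sup_eq_top ▸ LieSubmodule.mem_top z)
      rw [map_add, traceForm_comm F Q M x k, mem_traceFormKer.1 hk]
      simpa using! hx ⟨j, hj⟩
    have hxm : (x : Q) ∈ K ⊓ J := (LieSubmodule.mem_inf K J _).2 ⟨hxK, x.2⟩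
    rw [hc.inf_eq_bot] at hxm
    exact Subtype.ext ((LieSubmodule.mem_bot _).1 hxm)
  let e := finBasis F J
  refine ⟨finrank F J, fun i => e i, fun i => B.dualBasis hB e i, fun h => ?_, fun i => ?_,
    fun x β => ?_⟩
  · have hJ : J = ⊥ := by
      rw [← LieSubmodule.toSubmodule_eq_bot]
      exact Submodule.finrank_eq_zero.1 h
    have hK : K = ⊤ := by simpa [hJ] using hc.sup_eq_top
    refine LinearMap.ext fun x => ?_
    exact mem_traceFormKer.1 (show x ∈ K from hK ▸ LieSubmodule.mem_top x)
  · have := LinearMap.BilinForm.apply_dualBasis_right hB hsymm e i i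
    simpa using! this
  · exact B.sum_dualBasis_skew hB hsymm e (lieAction F Q J x)
      (fun v w => traceForm_apply_lie_apply' F Q M x v w)
      (β.compl₁₂ J.toSubmodule.subtype J.toSubmodule.subtype)

variable [FiniteDimensional F M]

/-- A vanishing trace form makes [Q,Q] = Q act nilpotently, so there is a nonzero invariant vector;
by irreducibility the invariants are everything. -/
theorem lie_eq_zero_of_isIrreducible_of_traceForm_eq_zero [CharZero F] [IsKilling F Q]
    [IsIrreducible F Q M] (h : traceForm F Q M = 0) (x : Q) (m : M) : ⁅x, m⁆ = 0 := by
  have hn := isNilpotent_derivedSeries_of_traceForm_eq_zero h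
  have hD : derivedSeries F Q 1 = ⊤ := IsKilling.lie_top_top
  have : Nontrivial M := LieModule.nontrivial_of_isIrreducible F Q M
  have := nontrivial_max_triv_of_isNilpotent F (derivedSeries F Q 1) M
  obtain ⟨m₀, hm₀⟩ := exists_ne (0 : maxTrivSubmodule F (derivedSeries F Q 1) M)
  have hmem : (m₀ : M) ∈ maxTrivSubmodule F Q M := fun y =>
    m₀.2 ⟨y, hD ▸ LieSubmodule.mem_top y⟩
  have htop : maxTrivSubmodule F Q M = ⊤ := by
    refine (eq_bot_or_eq_top (maxTrivSubmodule F Q M)).resolve_left fun hbot => hm₀ ?_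
    rw [hbot] at hmem
    exact Subtype.ext ((LieSubmodule.mem_bot _).1 hmem)
  exact (htop ▸ LieSubmodule.mem_top m : m ∈ maxTrivSubmodule F Q M) x

/-- Whitehead's first lemma for irreducible modules. -/
theorem exists_eq_lie_of_isIrreducible [CharZero F] [IsKilling F Q]
    [IsIrreducible F Q M] (f : Q →ₗ[F] M) (hf : ∀ x y, f ⁅x, y⁆ = ⁅x, f y⁆ - ⁅y, f x⁆) :
    ∃ m : M, ∀ x, f x = ⁅x, m⁆ := by
  obtain ⟨n, e, d, hn, hed, hinv⟩ := exists_casimir (F := F) (Q := Q) (M := M)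
  rcases Nat.eq_zero_or_pos n with h0 | hpos
  -- Without a Casimir operator the action is trivial, so f vanishes on [Q,Q] = Q.
  · have ht := lie_eq_zero_of_isIrreducible_of_traceForm_eq_zero (hn h0)
    refine ⟨0, fun x => ?_⟩
    rw [IsKilling.eq_zero_of_forall_lie f fun x y => by rw [hf, ht, ht, sub_zero]]
    simp
  let C : M →ₗ[F] M := ∑ i, lieAction F Q M (e i) ∘ₗ lieAction F Q M (d i)
  have hC (m : M) : C m = ∑ i, ⁅e i, ⁅d i, m⁆⁆ := by simp [C]
  have hcomm (x : Q) (m : M) : C ⁅x, m⁆ = ⁅x, C m⁆ := by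
    -- Invariance is applied to β(a, b) = a·(b·m); for `hcas` below, to β(a, b) = a·f(b).
    have := hinv x ((lieAction F Q M).compl₂ ((lieAction F Q M).flip m))
    rw [hC, hC, lie_sum, ← sub_eq_zero, ← neg_eq_zero, ← this, neg_sub, ← Finset.sum_sub_distrib]
    refine Finset.sum_congr rfl fun i _ => ?_
    simp only [LinearMap.compl₂_apply, LinearMap.flip_apply, lieAction_apply, lie_lie, lie_sub]
    abel
  have hcas (x : Q) : C (f x) = ⁅x, ∑ i, ⁅e i, f (d i)⁆⁆ := by
    have := hinv x ((lieAction F Q M).compl₂ f)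
    rw [hC, lie_sum, ← sub_eq_zero, ← neg_eq_zero, ← this, neg_sub, ← Finset.sum_sub_distrib]
    refine Finset.sum_congr rfl fun i _ => ?_
    simp only [LinearMap.compl₂_apply, lieAction_apply, hf, lie_lie, lie_sub]
    abel
  have htr : LinearMap.trace F M C = n := by
    have h (i : Fin n) : LinearMap.trace F M (lieAction F Q M (e i) ∘ₗ lieAction F Q M (d i)) = 1 :=
      hed i
    simp [C, h]
  -- Schur's argument: ker C is a submodule, and it is not all of M because tr C = n ≠ 0 in
  -- characteristic zero.
  let N : LieSubmodule F Q M :=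
    { LinearMap.ker C with
      lie_mem := fun {x m} hm => by
        have hm : C m = 0 := hm
        show C ⁅x, m⁆ = 0
        rw [hcomm, hm, lie_zero] }
  have hN : N = ⊥ := by
    by_contra hne
    have htop := (eq_bot_or_eq_top N).resolve_left hne
    have : C = 0 := by
      ext m
      exact (htop ▸ LieSubmodule.mem_top m : m ∈ N)
    rw [this, map_zero] at htr
    exact hpos.ne' (by exact_mod_cast htr.symm)
  have hinj : LinearMap.ker C = ⊥ := congrArg LieSubmodule.toSubmodule hN
  obtain ⟨m, hm⟩ := LinearMap.surjective_of_injective (LinearMap.ker_eq_bot.1 hinj)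
    (∑ i, ⁅e i, f (d i)⁆)
  refine ⟨m, fun x => LinearMap.ker_eq_bot.1 hinj ?_⟩
  rw [hcas, hcomm, hm]

/-- **Whitehead's first lemma**. -/
theorem exists_eq_lie_of_isKilling [CharZero F] [IsKilling F Q] (f : Q →ₗ[F] M)
    (hf : ∀ x y, f ⁅x, y⁆ = ⁅x, f y⁆ - ⁅y, f x⁆) : ∃ m : M, ∀ x, f x = ⁅x, m⁆ := by
  induction h : finrank F M using Nat.strong_induction_on generalizing M with
  | _ k ih =>
  rcases subsingleton_or_nontrivial M with hM | hM
  · exact ⟨0, fun x => Subsingleton.elim _ _⟩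
  by_cases hirr : ∀ N : LieSubmodule F Q M, N ≠ ⊥ → N = ⊤
  · have := IsIrreducible.mk hirr
    exact exists_eq_lie_of_isIrreducible f hf
  push Not at hirr
  obtain ⟨N, hbot, htop⟩ := hirr
  have hlt : finrank F N < k := h ▸ Submodule.finrank_lt
    (fun h => htop ((LieSubmodule.toSubmodule_eq_top N).1 h))
  have hlt' : finrank F (M ⧸ N) < k := by
    have := Submodule.finrank_quotient_add_finrank N.toSubmodule
    have hpos : 0 < finrank F N.toSubmodule := Nat.pos_of_ne_zero fun h =>
      hbot ((LieSubmodule.toSubmodule_eq_bot N).1 (Submodule.finrank_eq_zero.1 h))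
    change finrank F (M ⧸ N.toSubmodule) < k
    omega
  have : FiniteDimensional F (M ⧸ N) :=
    inferInstanceAs (FiniteDimensional F (M ⧸ N.toSubmodule))
  -- Modulo N, f is inner, given by some m. Then f − (x ↦ x·m) is a derivation into N, to which
  -- induction applies again.
  obtain ⟨q, hq⟩ := ih _ hlt' ((LieSubmodule.Quotient.mk' N).toLinearMap ∘ₗ f)
    (fun x y => congrArg (LieSubmodule.Quotient.mk' N) (hf x y)) rfl
  obtain ⟨m, rfl⟩ := LieSubmodule.Quotient.surjective_mk' N q
  have hmem (x : Q) : (f - (lieAction F Q M).flip m) x ∈ N.toSubmodule := by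
    rw [LieSubmodule.mem_toSubmodule, ← LieSubmodule.Quotient.mk_eq_zero]
    exact (LieSubmodule.Quotient.mk' N).toLinearMap.map_sub _ _ |>.trans (sub_eq_zero.2 (hq x))
  let g : Q →ₗ[F] N := (f - (lieAction F Q M).flip m).codRestrict N.toSubmodule hmem
  obtain ⟨m', hm'⟩ := ih _ hlt g
    (fun x y => Subtype.ext (by
      change f ⁅x, y⁆ - ⁅⁅x, y⁆, m⁆ = ⁅x, f y - ⁅y, m⁆⁆ - ⁅y, f x - ⁅x, m⁆⁆
      rw [hf, lie_lie, lie_sub, lie_sub]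
      abel)) rfl
  refine ⟨m + m', fun x => ?_⟩
  have : f x - ⁅x, m⁆ = ⁅x, (m' : M)⁆ := congrArg Subtype.val (hm' x)
  rw [lie_add, ← this, add_sub_cancel]

end LieModule

end

namespace LeftLeibniz

/-! ### The Lie algebra L/Leib(L) and its modules. -/

section Quotient

variable {F : Type u} {L : Type v} [Field F] [NonUnitalNonAssocRing L] [Module F L]

theorem mul_self_mem_leibnizKernel (x : L) : x * x ∈ leibnizKernel F L :=
  Submodule.subset_span ⟨x, rfl⟩

theorem add_mul_swap_mem_leibnizKernel (x y : L) : x * y + y * x ∈ leibnizKernel F L := by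
  have h := sub_mem (sub_mem (mul_self_mem_leibnizKernel (F := F) (x + y))
    (mul_self_mem_leibnizKernel x)) (mul_self_mem_leibnizKernel y)
  convert h using 1
  simp only [mul_add, add_mul]
  abel

theorem mul_self_mul [IsLeftLeibniz L] (x y : L) : (x * x) * y = 0 := by
  have := IsLeftLeibniz.leibniz x x y
  simpa using this

variable {M : Type w} [AddCommGroup M] [Module F M]

theorem Bimodule.left_eq_zero (B : Bimodule F L M) {a : L} (ha : a ∈ leibnizKernel F L) :
    B.left a = 0 := by
  suffices leibnizKernel F L ≤ LinearMap.ker B.left from this ha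
  rw [leibnizKernel, Submodule.span_le]
  rintro _ ⟨x, rfl⟩
  ext m
  simp [B.llm]

variable [IsScalarTower F L L] [IsLeftLeibniz L]

theorem leibnizKernel_mul {a : L} (ha : a ∈ leibnizKernel F L) (y : L) : a * y = 0 := by
  suffices leibnizKernel F L ≤ LinearMap.ker (LinearMap.mulRight F y) from this ha
  rw [leibnizKernel, Submodule.span_le]
  rintro _ ⟨x, rfl⟩
  exact mul_self_mul x y

/-- Polarised squares put ya + ay in the kernel, and ay = 0. -/
theorem mul_mem_leibnizKernel (y : L) {a : L} (ha : a ∈ leibnizKernel F L) :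
    y * a ∈ leibnizKernel F L := by
  simpa [leibnizKernel_mul ha] using add_mul_swap_mem_leibnizKernel (F := F) y a

variable [SMulCommClass F L L]

variable (F L) in
/-- The quotient of a left Leibniz algebra by its Leibniz kernel. -/
abbrev LieQuotient : Type v := L ⧸ leibnizKernel F L

variable (F L) in
/-- The product induced on the quotient by the Leibniz kernel. -/
def quotientMul : LieQuotient F L →ₗ[F] LieQuotient F L →ₗ[F] LieQuotient F L :=
  (leibnizKernel F L).liftQ
    { toFun := fun x => (leibnizKernel F L).mapQ (leibnizKernel F L) (LinearMap.mulLeft F x)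
        fun _ ha => mul_mem_leibnizKernel x ha
      map_add' := fun x y => by
        ext z
        exact congrArg (leibnizKernel F L).mkQ (add_mul x y z)
      map_smul' := fun c x => by
        ext z
        exact congrArg (leibnizKernel F L).mkQ (smul_mul_assoc c x z) }
    fun a ha => by
      rw [LinearMap.mem_ker]
      ext z
      exact congrArg (leibnizKernel F L).mkQ (leibnizKernel_mul ha z)

instance : LieRing (LieQuotient F L) where
  bracket x y := quotientMul F L x y
  add_lie x y z := LinearMap.map_add₂ (quotientMul F L) x y z
  lie_add x y z := map_add (quotientMul F L x) y z
  lie_self x := by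
    obtain ⟨x, rfl⟩ := Submodule.mkQ_surjective _ x
    exact (Submodule.Quotient.mk_eq_zero _).2 (mul_self_mem_leibnizKernel x)
  leibniz_lie x y z := by
    obtain ⟨x, rfl⟩ := Submodule.mkQ_surjective _ x
    obtain ⟨y, rfl⟩ := Submodule.mkQ_surjective _ y
    obtain ⟨z, rfl⟩ := Submodule.mkQ_surjective _ z
    exact congrArg (leibnizKernel F L).mkQ (IsLeftLeibniz.leibniz x y z)

instance : LieAlgebra F (LieQuotient F L) where
  lie_smul c x y := map_smul (quotientMul F L x) c y

/-- An abelian ideal of the quotient pulls back to a solvable ideal of L, which semisimplicity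
places inside Leib(L). -/
theorem IsSemisimple.hasTrivialRadical (h : IsSemisimple F L) :
    LieAlgebra.HasTrivialRadical F (LieQuotient F L) := by
  rw [LieAlgebra.hasTrivialRadical_iff_no_abelian_ideals]
  intro I hI
  have hprod {x y : L} (hx : (leibnizKernel F L).mkQ x ∈ I) (hy : (leibnizKernel F L).mkQ y ∈ I) :
      x * y ∈ leibnizKernel F L := by
    rw [← Submodule.Quotient.mk_eq_zero]
    exact congrArg Subtype.val (hI.trivial ⟨_, hx⟩ ⟨_, hy⟩)
  have hle := h (I.toSubmodule.comap (leibnizKernel F L).mkQ)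
    (fun a ha x => ⟨lie_mem_right F _ I ((leibnizKernel F L).mkQ x) _ ha,
      lie_mem_left F _ I _ ((leibnizKernel F L).mkQ x) ha⟩)
    -- Two steps suffice: products of elements of the preimage lie in Leib(L), and Leib(L)·L = 0.
    ⟨2, by
      have h₁ : derivedSeries (I.toSubmodule.comap (leibnizKernel F L).mkQ) 1 ≤
          leibnizKernel F L := by
        refine Submodule.span_le.2 ?_
        rintro _ ⟨x, hx, y, hy, rfl⟩
        exact hprod hx hy
      refine Submodule.span_eq_bot.2 ?_
      rintro _ ⟨x, hx, y, hy, rfl⟩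
      exact leibnizKernel_mul (h₁ hx) y⟩
  rw [eq_bot_iff]
  intro q hq
  obtain ⟨x, rfl⟩ := Submodule.mkQ_surjective _ q
  exact (LieSubmodule.mem_bot _).2 ((Submodule.Quotient.mk_eq_zero _).2 (hle hq))

/-- The left action of the Lie algebra `L / Leib(L)` on an `L`-bimodule. -/
def Bimodule.quotientLeft (B : Bimodule F L M) : LieQuotient F L →ₗ[F] M →ₗ[F] M :=
  (leibnizKernel F L).liftQ B.left fun _ ha => B.left_eq_zero ha

/-- An `L`-bimodule with its left action, as a module over the Lie algebra `L / Leib(L)`. -/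
abbrev Bimodule.lieRingModule (B : Bimodule F L M) : LieRingModule (LieQuotient F L) M where
  bracket x m := B.quotientLeft x m
  add_lie x y m := by simp
  lie_add x m n := by simp
  leibniz_lie x y m := by
    obtain ⟨x, rfl⟩ := Submodule.mkQ_surjective _ x
    obtain ⟨y, rfl⟩ := Submodule.mkQ_surjective _ y
    change B.left x (B.left y m) = B.left (x * y) m + B.left y (B.left x m)
    rw [B.llm, sub_add_cancel]

theorem Bimodule.lieModule (B : Bimodule F L M) :
    letI := B.lieRingModule
    LieModule F (LieQuotient F L) M :=
  letI := B.lieRingModule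
  { smul_lie := fun c x m => by
      change B.quotientLeft (c • x) m = c • B.quotientLeft x m
      simp
    lie_smul := fun c x m => map_smul (B.quotientLeft x) c m }

end Quotient

/-! ### Cocycles and coboundaries in degree one. -/

section LowDegree

variable {F : Type u} {L : Type v} {M : Type w} [Field F] [NonUnitalNonAssocRing L]
  [Module F L] [AddCommGroup M] [Module F M] [IsScalarTower F L L] [SMulCommClass F L L]

/-- Both sums are empty in degree zero; the sign of the right action is (−1)¹. -/
theorem coboundary_zero_apply (B : Bimodule F L M) (c : Cochain F L M 0) (x : Fin 1 → L) :
    coboundary B 0 c x = - B.right (c ![]) (x 0) := by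
  simp [coboundary, coboundaryFun, Subsingleton.elim _ (![] : Fin 0 → L)]

theorem coboundary_one_apply (B : Bimodule F L M) (c : Cochain F L M 1) (x y : L) :
    coboundary B 1 c ![x, y] = B.left x (c ![y]) + B.right (c ![x]) y - c ![x * y] := by
  have h₀ : (0 : Fin 2).removeNth ![x, y] = ![y] := by ext i; fin_cases i; rfl
  have h₁ : (Fin.last 1).removeNth ![x, y] = ![x] := by ext i; fin_cases i; rfl
  have h₂ : (0 : Fin 2).removeNth (Function.update ![x, y] 1 (x * y)) = ![x * y] := by
    ext i; fin_cases i; rfl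
  have h₃ : Finset.Ioi (0 : Fin 2) = {1} := by decide
  have h₄ : Finset.Ioi (1 : Fin 2) = ∅ := by decide
  change coboundaryFun B c ![x, y] = _
  rw [coboundaryFun, Fin.sum_univ_two, Fin.sum_univ_one, h₁, h₃, h₄, Finset.sum_singleton,
    Finset.sum_empty]
  simp only [Fin.castSucc_zero, h₀]
  have h₅ : Function.update ![x, y] 1 (![x, y] 0 * ![x, y] 1) =
      Function.update ![x, y] 1 (x * y) := rfl
  rw [h₅, h₂]
  simp [sub_eq_add_neg]

theorem mem_cocycles_one (B : Bimodule F L M) (c : Cochain F L M 1) :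
    c ∈ cocycles B 1 ↔ ∀ x y, c ![x * y] = B.left x (c ![y]) + B.right (c ![x]) y := by
  constructor
  · intro h x y
    have := coboundary_one_apply B c x y
    rw [LinearMap.mem_ker.1 h] at this
    exact (sub_eq_zero.1 this.symm).symm
  · intro h
    refine LinearMap.mem_ker.2 (MultilinearMap.ext fun x => ?_)
    have hx : x = ![x 0, x 1] := by ext i; fin_cases i <;> rfl
    rw [hx, coboundary_one_apply, h, sub_self]
    rfl

theorem mem_coboundaries_one (B : Bimodule F L M) (c : Cochain F L M 1) :
    c ∈ coboundaries B 1 ↔ ∃ m, ∀ x, c ![x] = - B.right m x := by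
  constructor
  · rintro ⟨b, rfl⟩
    exact ⟨b ![], fun x => coboundary_zero_apply B b ![x]⟩
  · rintro ⟨m, hm⟩
    refine ⟨MultilinearMap.constOfIsEmpty F _ m, MultilinearMap.ext fun x => ?_⟩
    have hx : x = ![x 0] := by ext i; fin_cases i; rfl
    rw [coboundary_zero_apply, hx, hm]
    simp

/-- The identity map is a cocycle, since the condition reads c(xy) = x c(y). Coboundaries x ↦ −m·x
vanish, so it is not one of them. -/
theorem nontrivial_HL_antisymmetricAdjoint [IsLeftLeibniz L] [Nontrivial L] :
    Nontrivial (HL (antisymmetricAdjoint F L) 1) := by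
  rw [Submodule.Quotient.nontrivial_iff]
  intro h
  rw [Submodule.submoduleOf_eq_top] at h
  let c : Cochain F L L 1 := MultilinearMap.ofSubsingleton F L L (0 : Fin 1) LinearMap.id
  have hc (x : L) : c ![x] = x := by simp [c]
  have hmem : c ∈ cocycles (antisymmetricAdjoint F L) 1 := by
    rw [mem_cocycles_one]
    intro x y
    simp [hc, antisymmetricAdjoint]
  obtain ⟨m, hm⟩ := (mem_coboundaries_one _ c).1 (h hmem)
  obtain ⟨x, hx⟩ := exists_ne (0 : L)
  apply hx
  rw [← hc x, hm]
  simp [antisymmetricAdjoint]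

end LowDegree

/-! ### The cross product algebra, a semisimple example over every field. -/

section CrossProduct

/-- The three-dimensional Lie algebra `F³` with the cross product. -/
def CrossAlgebra (F : Type u) : Type u := Fin 3 → F

namespace CrossAlgebra

open scoped Matrix

variable (F : Type u) [Field F]

instance : AddCommGroup (CrossAlgebra F) := inferInstanceAs (AddCommGroup (Fin 3 → F))

instance : Module F (CrossAlgebra F) := inferInstanceAs (Module F (Fin 3 → F))

instance : FiniteDimensional F (CrossAlgebra F) :=
  inferInstanceAs (FiniteDimensional F (Fin 3 → F))

instance : Nontrivial (CrossAlgebra F) := inferInstanceAs (Nontrivial (Fin 3 → F))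

/-- The type synonym keeps this product apart from the pointwise one on `Fin 3 → F`. -/
instance : NonUnitalNonAssocRing (CrossAlgebra F) where
  mul x y := crossProduct (R := F) x y
  left_distrib x y z := map_add (crossProduct (R := F) x) y z
  right_distrib x y z := LinearMap.map_add₂ (crossProduct (R := F)) x y z
  zero_mul x := LinearMap.map_zero₂ (crossProduct (R := F)) x
  mul_zero x := map_zero (crossProduct (R := F) x)

instance : IsScalarTower F (CrossAlgebra F) (CrossAlgebra F) where
  smul_assoc c x y := LinearMap.map_smul₂ (crossProduct (R := F)) c x y

instance : SMulCommClass F (CrossAlgebra F) (CrossAlgebra F) where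
  smul_comm c x y := (map_smul (crossProduct (R := F) x) c y).symm

instance : IsLeftLeibniz (CrossAlgebra F) where
  leibniz x y z := leibniz_cross (R := F) x y z

variable {F}

theorem mul_def (x y : CrossAlgebra F) :
    x * y = ![x 1 * y 2 - x 2 * y 1, x 2 * y 0 - x 0 * y 2, x 0 * y 1 - x 1 * y 0] :=
  cross_apply (R := F) x y

/-- The standard basis vectors. -/
def basisVec (i : Fin 3) : CrossAlgebra F := Pi.single i (1 : F)

theorem smul_apply (c : F) (x : CrossAlgebra F) (k : Fin 3) : (c • x) k = c * x k := rfl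

/-- This is a × (b × v) = (a·v) b − (a·b) v for orthogonal a and b. It extracts the vectors eⱼ, j ≠
i, from an ideal element with vᵢ ≠ 0. -/
theorem basisVec_mul_basisVec_mul {i j : Fin 3} (h : i ≠ j) (v : CrossAlgebra F) :
    basisVec i * (basisVec j * v) = v i • basisVec j := by
  funext k
  rw [mul_def, mul_def]
  fin_cases i <;> fin_cases j <;> first | exact absurd rfl h | skip
  all_goals fin_cases k
  all_goals rw [smul_apply]; simp [basisVec]

/-- Indices are cyclic modulo 3. Each basis vector is thus a product, which makes the algebra
perfect and so not solvable. -/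
theorem basisVec_mul_succ (i : Fin 3) :
    basisVec (i + 1) * basisVec (i + 2) = (basisVec i : CrossAlgebra F) := by
  funext k
  rw [mul_def]
  fin_cases i <;> fin_cases k <;> simp [basisVec]

theorem eq_top_of_basisVec_mem {I : Submodule F (CrossAlgebra F)} (h : ∀ i, basisVec i ∈ I) :
    I = ⊤ := by
  refine eq_top_iff.2 fun v _ => ?_
  have hv : v = ∑ i, v i • basisVec i := pi_eq_sum_univ' (R := F) v
  rw [hv]
  exact Submodule.sum_mem _ fun i _ => I.smul_mem _ (h i)

theorem derivedSeries_top (n : ℕ) : derivedSeries (⊤ : Submodule F (CrossAlgebra F)) n = ⊤ := by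
  induction n with
  | zero => rfl
  | succ n ih =>
    refine eq_top_of_basisVec_mem fun i => Submodule.subset_span ?_
    simp only [ih]
    exact ⟨_, Submodule.mem_top, _, Submodule.mem_top, (basisVec_mul_succ i).symm⟩

theorem eq_bot_or_eq_top {I : Submodule F (CrossAlgebra F)} (hI : IsIdeal I) : I = ⊥ ∨ I = ⊤ := by
  refine or_iff_not_imp_left.2 fun hne => ?_
  obtain ⟨v, hv, hv0⟩ := Submodule.exists_mem_ne_zero_of_ne_bot hne
  obtain ⟨i, hi⟩ : ∃ i, v i ≠ 0 := Function.ne_iff.1 hv0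
  have hj {i j : Fin 3} (hij : i ≠ j) {v : CrossAlgebra F} (hv : v ∈ I) (hi : v i ≠ 0) :
      basisVec j ∈ I := by
    have := (hI _ (hI v hv (basisVec j)).1 (basisVec i)).1
    rwa [basisVec_mul_basisVec_mul hij, I.smul_mem_iff hi] at this
  refine eq_top_of_basisVec_mem fun j => ?_
  by_cases hij : i = j
  · subst hij
    -- The extraction requires distinct indices, so eᵢ is reached in two moves through eᵢ₊₁.
    have h : i + 1 ≠ i := by fin_cases i <;> decide
    exact hj h (hj h.symm hv hi) (by simp [basisVec])
  · exact hj hij hv hi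

variable (F) in
theorem isSemisimple : IsSemisimple F (CrossAlgebra F) := by
  rintro I hI ⟨r, hr⟩
  rcases eq_bot_or_eq_top hI with rfl | rfl
  · exact bot_le
  · rw [derivedSeries_top] at hr
    exact absurd hr.symm bot_ne_top

end CrossAlgebra

end CrossProduct

end LeftLeibniz

/-! ### Descent to the Lie quotient and conclusion. -/

theorem LeftLeibniz.IsSemisimple.subsingleton_HL_one {F : Type u} [Field F] [CharZero F]
    {L : Type v} [NonUnitalNonAssocRing L] [Module F L] [IsScalarTower F L L]
    [SMulCommClass F L L] [IsLeftLeibniz L] [FiniteDimensional F L]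
    (hL : LeftLeibniz.IsSemisimple F L) {M : Type w} [AddCommGroup M] [Module F M]
    [FiniteDimensional F M] (B : LeftLeibniz.Bimodule F L M) (hB : B.IsSymmetric) :
    Subsingleton (LeftLeibniz.HL B 1) := by
  rw [Submodule.Quotient.subsingleton_iff, Submodule.submoduleOf_eq_top]
  intro c hc
  have hB (x : L) (m : M) : B.right m x = - B.left x m := hB x m
  rw [LeftLeibniz.mem_cocycles_one] at hc
  simp only [hB, ← sub_eq_add_neg] at hc
  rw [LeftLeibniz.mem_coboundaries_one]
  simp only [hB, neg_neg]
  let g : L →ₗ[F] M := (MultilinearMap.ofSubsingleton F L M (0 : Fin 1)).symm c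
  have hg (x : L) : g x = c ![x] := by
    simp only [g, MultilinearMap.ofSubsingleton_symm_apply_apply]
    congr 1
    ext i; fin_cases i; rfl
  -- On a square the cocycle identity gives c(xx) = x·c(x) − x·c(x) = 0.
  let f : LeftLeibniz.LieQuotient F L →ₗ[F] M := (LeftLeibniz.leibnizKernel F L).liftQ g <| by
    rw [LeftLeibniz.leibnizKernel, Submodule.span_le]
    rintro _ ⟨x, rfl⟩
    simp [hg, hc]
  -- In characteristic zero a trivial radical yields `IsKilling` by instance search.
  have := hL.hasTrivialRadical
  let _ := B.lieRingModule
  have := B.lieModule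
  obtain ⟨m, hm⟩ := LieModule.exists_eq_lie_of_isKilling f fun x y => by
    obtain ⟨x, rfl⟩ := Submodule.mkQ_surjective _ x
    obtain ⟨y, rfl⟩ := Submodule.mkQ_surjective _ y
    change g (x * y) = B.left x (g y) - B.left y (g x)
    rw [hg, hg, hg, hc]
  exact ⟨m, fun x => (hg x).symm.trans (hm ((LeftLeibniz.leibnizKernel F L).mkQ x))⟩

theorem theorem7p11 (F : Type u) [Field F] [CharZero F] :
    (∀ (L : Type v) [NonUnitalNonAssocRing L] [Module F L] [IsScalarTower F L L]
        [SMulCommClass F L L] [IsLeftLeibniz L] [FiniteDimensional F L],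
      LeftLeibniz.IsSemisimple F L →
        (∀ (M : Type w) [AddCommGroup M] [Module F M] [FiniteDimensional F M]
          (B : LeftLeibniz.Bimodule F L M), B.IsSymmetric → Subsingleton (LeftLeibniz.HL B 1)) ∧
        (Nontrivial L →
          (LeftLeibniz.antisymmetricAdjoint F L).IsAntisymmetric ∧
          Nontrivial (LeftLeibniz.HL (LeftLeibniz.antisymmetricAdjoint F L) 1))) ∧
    (∃ (L : Type u) (_ : NonUnitalNonAssocRing L) (_ : Module F L) (_ : IsScalarTower F L L)
        (_ : SMulCommClass F L L) (_ : IsLeftLeibniz L) (_ : FiniteDimensional F L),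
      LeftLeibniz.IsSemisimple F L ∧
        ∃ (M : Type u) (_ : AddCommGroup M) (_ : Module F M) (_ : FiniteDimensional F M)
          (B : LeftLeibniz.Bimodule F L M),
          B.IsAntisymmetric ∧ Nontrivial (LeftLeibniz.HL B 1)) := by
  refine ⟨fun L _ _ _ _ _ _ hL => ⟨fun M _ _ _ B hB => hL.subsingleton_HL_one B hB,
    fun _ => ⟨fun _ _ => rfl, LeftLeibniz.nontrivial_HL_antisymmetricAdjoint⟩⟩, ?_⟩
  exact ⟨LeftLeibniz.CrossAlgebra F, inferInstance, inferInstance, inferInstance, inferInstance,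
    inferInstance, inferInstance, LeftLeibniz.CrossAlgebra.isSemisimple F,
    LeftLeibniz.CrossAlgebra F, inferInstance, inferInstance, inferInstance,
    LeftLeibniz.antisymmetricAdjoint F _, fun _ _ => rfl,
    LeftLeibniz.nontrivial_HL_antisymmetricAdjoint⟩
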